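/- Let $\mathcal G=(\mathcal V,\mathcal E)$, $\mathcal E\subset\mathcal V\times\mathcal V$, be a graph (finite or infinite). An open self-avoiding path is a sequence $S=(s_1,\dots,s_k)$, $k\ge 1$, of pairwise distinct nodes with $(s_j,s_{j+1})\in\mathcal E$ for $1\le j\le k-1$. Let $\mathcal C$ be a class of open self-avoiding paths of $\mathcal G$, let $\nu$ be a (discrete) probability distribution on $\mathcal C$, and let $\psi\in\mathbb R$ with $|\psi|<1/9$. Let $\mathbb P_0$ be the law on $\mathbb R^{\mathcal V}$ of a vector $X=(X_i)_{i\in\mathcal V}$ of independent standard normal variables. For $S=(s_1,\dots,s_k)\in\mathcal C$ let $\mathbb P_{S,\psi}$ be the law of a vector $X$ of standard normal variables such that $(X_i)_{i\in S}$ is a stationary Gaussian autoregressive sequence of order $1$ along $S$ with coefficient $\psi$ (that is, $X_{s_1}\sim N(0,1)$, the variables $X_{s_{j+1}}-\psi X_{s_j}$, $1\le j\le k-1$, are $N(0,1-\psi^2)$, and all of these are independent), while the $(X_i)_{i\notin S}$ are independent standard normal variables, independent of $(X_i)_{i\in S}$. Define the Bayes risk $$\bar R^*_{\nu,\psi}=\inf_f\Big(\mathbb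 P_0\{f(X)=1\}+\sum_{S\in\mathcal C}\nu(S)\,\mathbb P_{S,\psi}\{f(X)=0\}\Big),$$ where the infimum is over all measurable functions $f:\mathbb R^{\mathcal V}\to\{0,1\}$. Then $$\bar R^*_{\nu,\psi}\ \ge\ 1-\frac12\sqrt{\mathbb E_{\nu\otimes\nu}\big[\exp\big(\lambda(\psi)\,|S\cap T|\big)\big]-1},\qquad \lambda(\psi)=\frac14\left[\left(\frac{1-|\psi|}{1-9|\psi|}\right)^{1/2}-\frac{1+|\psi|}{1-|\psi|}\right],$$ where $S,T$ are drawn independently from $\nu$ and $|S\cap T|$ is the number of nodes common to $S$ and $T$. If the expectation is infinite, the right-hand side is $-\infty$. -/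

import Mathlib

open MeasureTheory ProbabilityTheory
open scoped ENNReal

namespace PathDetection

variable {V : Type*}

/-- An open self-avoiding path `s = (s₁, …, s_k)`, `k ≥ 1`: consecutive nodes are joined by an edge
and no node is repeated. The edge set is an arbitrary set of ordered pairs of nodes. -/
def IsSelfAvoidingPath (G : Digraph V) (s : List V) : Prop :=
  s ≠ [] ∧ s.IsChain G.Adj ∧ s.Nodup

/-- The law of `X` under the null: independent standard normal coordinates. -/
noncomputable def nullLaw (V : Type*) : Measure (V → ℝ) :=
  Measure.infinitePi (fun _ : V => gaussianReal 0 1)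

open Classical in
/-- Turns white noise `z` into a vector `x` that is autoregressive along the path `(s₁, …, s_k)`:
`x s₁ = z s₁`, then successively `x s_{j+1} = ψ * x s_j + √(1 - ψ²) * z s_{j+1}`,
and `x i = z i` for the nodes `i` off the path. -/
noncomputable def arMap (ψ : ℝ) : List V → (V → ℝ) → (V → ℝ)
  | [], z => z
  | [_], z => z
  | a :: b :: l, z =>
      arMap ψ (b :: l) (Function.update z b (ψ * z a + Real.sqrt (1 - ψ ^ 2) * z b))

theorem measurable_arMap (ψ : ℝ) : ∀ s : List V, Measurable (arMap ψ s)
  | [] => measurable_id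
  | [_] => measurable_id
  | a :: b :: l => by
      classical
      refine (measurable_arMap ψ (b :: l)).comp (measurable_pi_lambda _ fun i => ?_)
      by_cases h : i = b
      · subst h
        simp only [Function.update_self]
        fun_prop
      · simp only [Function.update_of_ne h]
        fun_prop

/-- The law of `X` when the path `s` is anomalous: a stationary Gaussian AR(1) sequence with
coefficient `ψ` along `s`, independent standard normal coordinates elsewhere. -/
noncomputable def altLaw (ψ : ℝ) (s : List V) : Measure (V → ℝ) :=
  (nullLaw V).map (arMap ψ s)

/-- The average risk of the test `f` under the prior `ν`: its type I error probability plus the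
`ν`-average of its type II error probabilities. -/
noncomputable def avgRisk {C : Set (List V)} (ν : PMF C) (ψ : ℝ) (f : (V → ℝ) → Fin 2) : ℝ≥0∞ :=
  nullLaw V {x | f x = 1} + ∑' s : C, ν s * altLaw ψ (s : List V) {x | f x = 0}

/-- The Bayes risk: the infimum of the average risk over all (measurable) tests. -/
noncomputable def bayesRisk {C : Set (List V)} (ν : PMF C) (ψ : ℝ) : ℝ≥0∞ :=
  ⨅ (f : (V → ℝ) → Fin 2) (_ : Measurable f), avgRisk ν ψ f

/-- The exponent `λ(ψ)`; it is nonnegative for `|ψ| < 1/9`. -/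
noncomputable def rate (ψ : ℝ) : ℝ :=
  1 / 4 * (Real.sqrt ((1 - |ψ|) / (1 - 9 * |ψ|)) - (1 + |ψ|) / (1 - |ψ|))

/-- The number `|S ∩ T|` of nodes that the paths `s` and `t` have in common. -/
noncomputable def overlap (s t : List V) : ℕ := ({v | v ∈ s} ∩ {v | v ∈ t}).ncard

/-- `E[exp (c |S ∩ T|)]` for `S, T` drawn independently from `ν`. It is `∞` if the series
diverges, which can happen when `C` is infinite. -/
noncomputable def expOverlap {C : Set (List V)} (ν : PMF C) (c : ℝ) : ℝ≥0∞ :=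
  ∑' (s : C) (t : C), ν s * ν t * ENNReal.ofReal (Real.exp (c * overlap (s : List V) t))

end PathDetection

/-!
The proof is the second-moment method. Under `|ψ| < 1`, the law of `X` with anomalous path `S` has a
density `L_S` with respect to white noise, a product of Mehler kernels along the path
(`altLaw_eq_withDensity`). Any test of white noise against the mixture `L = ∑ ν(S) L_S` has total
error at least `1 - (1 / 2) √(∫ L² - 1)` (`one_le_add_lintegral_add_sqrt`), and `∫ L²` is the
`ν ⊗ ν`-average of the correlations `∫ L_S L_T`. What remains is `∫ L_S L_T ≤ exp (λ(ψ) |S ∩ T|)`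
(`lintegral_pathLik_mul_pathLik_le`), which is obtained without determinants.

Under white noise the variables on `S` and those on `T` are independent given the variables on
`S ∩ T`, so that `L_S` and `L_T` can be replaced by their conditional expectations on the common
nodes (`lintegral_mul_chainLik`). The common nodes may be visited in very different orders by the
two paths, but `2 a b ≤ a² + b²` decouples them: it suffices to bound the second moment of the
marginal of a single path on `m` of its nodes by `exp (λ(ψ) m)`. This marginal is again a Gaussian
Markov chain, whose later steps have powers of `ψ` as coefficients, by the semigroup property of the
Mehler kernel (`lintegral_mehler_mul_mehler`).

For a chain, the second moment is computed by integrating out the variables from the last to the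
first. Gaussian integrals keep the integrand of the form `exp (a x²)`, and the weight
`a = 3 ψ² / 2` is preserved, up to a factor `exp (6 ψ²) ≤ exp (λ(ψ))` for each node
(`lintegral_mehler_sq_le`, `lintegral_margLik_sq_le`). The first-step coefficient `0` starts the
chain from its stationary law without a separate case.
-/

namespace PathDetection

variable {V : Type*}

/-! ### Gaussian integrals in one variable -/

theorem lintegral_exp_quadratic_gaussianReal {A q : ℝ} (hA : 0 ≤ A) (hq : 0 < q) (b d : ℝ) :
    ∫⁻ y, ENNReal.ofReal (A * Real.exp (-(q - 1) / 2 * y ^ 2 + b * y + d)) ∂gaussianReal 0 1 =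
      ENNReal.ofReal (A * (Real.sqrt q)⁻¹ * Real.exp (b ^ 2 / (2 * q) + d)) := by
  obtain ⟨v, hvq⟩ : ∃ v : NNReal, (v : ℝ) = q⁻¹ := ⟨⟨q⁻¹, by positivity⟩, rfl⟩
  have hv : v ≠ 0 := by
    rintro rfl
    exact (inv_pos.2 hq).ne hvq
  rw [gaussianReal_of_var_ne_zero 0 one_ne_zero,
    lintegral_withDensity_eq_lintegral_mul _ (measurable_gaussianPDF 0 1) (by fun_prop)]
  -- completing the square turns the integrand into a multiple of the density of `N(b / q, 1 / q)`
  have key : ∀ y : ℝ, (gaussianPDF 0 1 * fun y => ENNReal.ofReal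
        (A * Real.exp (-(q - 1) / 2 * y ^ 2 + b * y + d))) y =
      ENNReal.ofReal (A * (Real.sqrt q)⁻¹ * Real.exp (b ^ 2 / (2 * q) + d)) *
        ENNReal.ofReal (gaussianPDFReal (b / q) v y) := by
    intro y
    rw [Pi.mul_apply, gaussianPDF, ← ENNReal.ofReal_mul (gaussianPDFReal_nonneg _ _ _),
      ← ENNReal.ofReal_mul (by positivity)]
    congr 1
    simp only [gaussianPDFReal, NNReal.coe_one, hvq]
    have h1 : Real.sqrt (2 * Real.pi * q⁻¹) = Real.sqrt (2 * Real.pi * 1) * (Real.sqrt q)⁻¹ := by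
      rw [Real.sqrt_mul (by positivity), mul_one, Real.sqrt_inv]
    have h2 : Real.exp (-(y - 0) ^ 2 / (2 * 1)) *
        Real.exp (-(q - 1) / 2 * y ^ 2 + b * y + d) =
        Real.exp (b ^ 2 / (2 * q) + d) * Real.exp (-(y - b / q) ^ 2 / (2 * q⁻¹)) := by
      rw [← Real.exp_add, ← Real.exp_add]
      congr 1
      field_simp
      ring
    have h3 : Real.sqrt q ≠ 0 := (Real.sqrt_pos.2 hq).ne'
    rw [h1, mul_inv, inv_inv]
    calc _ = (Real.sqrt (2 * Real.pi * 1))⁻¹ * A * (Real.exp (-(y - 0) ^ 2 / (2 * 1)) *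
          Real.exp (-(q - 1) / 2 * y ^ 2 + b * y + d)) := by ring
      _ = _ := by rw [h2]; field_simp
  rw [lintegral_congr key, lintegral_const_mul _ (measurable_gaussianPDFReal _ _).ennreal_ofReal,
    lintegral_gaussianPDFReal_eq_one _ hv, mul_one]

/-- The Mehler kernel: the density at `y` of `N(ρ u, 1 - ρ²)` with respect to `N(0, 1)`,
that is, the likelihood ratio of one autoregressive step from `u` to `y` with coefficient `ρ`.
It is meaningful for `|ρ| < 1`. -/
noncomputable def mehler (ρ u y : ℝ) : ℝ≥0∞ :=
  ENNReal.ofReal ((Real.sqrt (1 - ρ ^ 2))⁻¹ *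
    Real.exp ((-ρ ^ 2 * y ^ 2 + 2 * ρ * u * y - ρ ^ 2 * u ^ 2) / (2 * (1 - ρ ^ 2))))

theorem measurable_mehler {α : Type*} [MeasurableSpace α] (ρ : ℝ) {f g : α → ℝ}
    (hf : Measurable f) (hg : Measurable g) :
    Measurable fun x => mehler ρ (f x) (g x) := by
  unfold mehler
  fun_prop

theorem mehler_zero (u y : ℝ) : mehler 0 u y = 1 := by
  simp [mehler]

/-- One step of the autoregression is a change of measure by the Mehler kernel. -/
theorem lintegral_autoregressive_step {ρ : ℝ} (hρ : |ρ| < 1) (u : ℝ) {G : ℝ → ℝ≥0∞}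
    (hG : Measurable G) :
    ∫⁻ y, G (ρ * u + Real.sqrt (1 - ρ ^ 2) * y) ∂gaussianReal 0 1 =
      ∫⁻ y, mehler ρ u y * G y ∂gaussianReal 0 1 := by
  have hpos : 0 < 1 - ρ ^ 2 := by
    have := (sq_lt_one_iff_abs_lt_one ρ).2 hρ
    linarith
  obtain ⟨v, hvρ⟩ : ∃ v : NNReal, (v : ℝ) = 1 - ρ ^ 2 := ⟨⟨1 - ρ ^ 2, hpos.le⟩, rfl⟩
  have hv : v ≠ 0 := by
    rintro rfl
    exact hpos.ne hvρ
  have hmap : (gaussianReal 0 1).map (fun y => ρ * u + Real.sqrt (1 - ρ ^ 2) * y) =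
      gaussianReal (ρ * u) v := by
    have h : (fun y : ℝ => ρ * u + Real.sqrt (1 - ρ ^ 2) * y) =
        (fun y => ρ * u + y) ∘ (fun y => Real.sqrt (1 - ρ ^ 2) * y) := rfl
    rw [h, ← Measure.map_map (by fun_prop) (by fun_prop), gaussianReal_map_const_mul,
      gaussianReal_map_const_add]
    congr 1
    · ring
    · ext
      simp [Real.sq_sqrt hpos.le, hvρ]
  rw [← lintegral_map (f := G) hG (by fun_prop), hmap, gaussianReal_of_var_ne_zero _ hv,
    gaussianReal_of_var_ne_zero 0 one_ne_zero,
    lintegral_withDensity_eq_lintegral_mul _ (measurable_gaussianPDF _ _) hG,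
    lintegral_withDensity_eq_lintegral_mul _ (measurable_gaussianPDF _ _)
      (g := fun y => mehler ρ u y * G y)
      ((measurable_mehler ρ measurable_const measurable_id).mul hG)]
  refine lintegral_congr fun y => ?_
  simp only [Pi.mul_apply, ← mul_assoc]
  congr 1
  rw [gaussianPDF, gaussianPDF, mehler, ← ENNReal.ofReal_mul (gaussianPDFReal_nonneg _ _ _)]
  congr 1
  simp only [gaussianPDFReal, NNReal.coe_one, hvρ]
  rw [Real.sqrt_mul (by positivity), mul_one, mul_inv]
  have h2 : Real.exp (-(y - ρ * u) ^ 2 / (2 * (1 - ρ ^ 2))) =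
      Real.exp (-(y - 0) ^ 2 / (2 * 1)) * Real.exp ((-ρ ^ 2 * y ^ 2 + 2 * ρ * u * y -
        ρ ^ 2 * u ^ 2) / (2 * (1 - ρ ^ 2))) := by
    rw [← Real.exp_add]
    congr 1
    field_simp
    ring
  rw [h2]
  ring

theorem lintegral_mehler {ρ : ℝ} (hρ : |ρ| < 1) (u : ℝ) :
    ∫⁻ y, mehler ρ u y ∂gaussianReal 0 1 = 1 := by
  simpa using (lintegral_autoregressive_step hρ u (G := fun _ => 1) measurable_const).symm

/-- The Chapman–Kolmogorov equation: the coefficients of successive autoregressive steps multiply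
when the intermediate variable is integrated out. -/
theorem lintegral_mehler_mul_mehler {ρ σ : ℝ} (hρ : |ρ| < 1) (hσ : |σ| < 1) (u w : ℝ) :
    ∫⁻ y, mehler ρ u y * mehler σ y w ∂gaussianReal 0 1 = mehler (ρ * σ) u w := by
  have hr : 0 < 1 - ρ ^ 2 := by
    have := (sq_lt_one_iff_abs_lt_one ρ).2 hρ
    linarith
  have hs : 0 < 1 - σ ^ 2 := by
    have := (sq_lt_one_iff_abs_lt_one σ).2 hσ
    linarith
  have hrs : 0 < 1 - ρ ^ 2 * σ ^ 2 := by nlinarith [sq_nonneg ρ, sq_nonneg σ]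
  have hq : 0 < (1 - ρ ^ 2 * σ ^ 2) / ((1 - ρ ^ 2) * (1 - σ ^ 2)) := by positivity
  have key : ∀ y, mehler ρ u y * mehler σ y w = ENNReal.ofReal
      (((Real.sqrt (1 - ρ ^ 2))⁻¹ * (Real.sqrt (1 - σ ^ 2))⁻¹) *
        Real.exp (-((1 - ρ ^ 2 * σ ^ 2) / ((1 - ρ ^ 2) * (1 - σ ^ 2)) - 1) / 2 * y ^ 2 +
          (ρ * u / (1 - ρ ^ 2) + σ * w / (1 - σ ^ 2)) * y +
          (-ρ ^ 2 * u ^ 2 / (2 * (1 - ρ ^ 2)) - σ ^ 2 * w ^ 2 / (2 * (1 - σ ^ 2))))) := by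
    intro y
    rw [mehler, mehler, ← ENNReal.ofReal_mul (by positivity), mul_mul_mul_comm, ← Real.exp_add]
    congr 3
    field_simp
    ring
  rw [lintegral_congr key, lintegral_exp_quadratic_gaussianReal (by positivity) hq, mehler]
  congr 2
  · rw [Real.sqrt_div' _ (by positivity), Real.sqrt_mul hr.le, mul_pow]
    have h1 := (Real.sqrt_pos.2 hr).ne'
    have h2 := (Real.sqrt_pos.2 hs).ne'
    field_simp
  · congr 1
    rw [mul_pow]
    field_simp
    ring

/-- The comparison `6 ψ² ≤ λ(ψ)`, which is all that the argument needs to know about the exponent: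
`√X ≥ 2 X / (1 + X)` replaces the square root by the rational function
`(1 - |ψ|) / (1 - 5 |ψ|)`. -/
theorem six_mul_sq_le_rate {ψ : ℝ} (hψ : |ψ| < 1 / 9) : 6 * ψ ^ 2 ≤ rate ψ := by
  rw [rate, ← sq_abs]
  have hu := abs_nonneg ψ
  set u := |ψ|
  have h1 : (1 - u) / (1 - 5 * u) ≤ Real.sqrt ((1 - u) / (1 - 9 * u)) := by
    have h9 : 0 < 1 - 9 * u := by linarith
    have h5 : 0 < 1 - 5 * u := by linarith
    apply Real.le_sqrt_of_sq_le
    rw [div_pow, div_le_div_iff₀ (by positivity) h9]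
    have : 0 ≤ (1 - u) * u ^ 2 := mul_nonneg (by linarith) (sq_nonneg u)
    nlinarith
  have h2 : 24 * u ^ 2 ≤ (1 - u) / (1 - 5 * u) - (1 + u) / (1 - u) := by
    have h5 : 0 < 1 - 5 * u := by linarith
    have h6 : 0 < 1 - u := by linarith
    rw [div_sub_div _ _ h5.ne' h6.ne', le_div_iff₀ (by positivity)]
    have h7 : (1 - 5 * u) * (1 - u) ≤ 1 := by nlinarith
    have h8 : 24 * u ^ 2 * ((1 - 5 * u) * (1 - u)) ≤ 24 * u ^ 2 * 1 := by gcongr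
    nlinarith
  linarith

/-- The second moment of one step. Weighted by `exp (3 ψ² y² / 2)`, the square of the Mehler kernel
integrates to at most `exp (λ(ψ))` times the same weight at the starting point. The weight
`3 ψ² / 2` is a convenient super-solution of the recursion that Gaussian integration induces on the
exponents. -/
theorem lintegral_mehler_sq_le {ψ ρ : ℝ} (hψ : |ψ| < 1 / 9) (hρ : |ρ| ≤ |ψ|) (u : ℝ) :
    ∫⁻ y, mehler ρ u y ^ 2 * ENNReal.ofReal (Real.exp (3 / 2 * ψ ^ 2 * y ^ 2)) ∂gaussianReal 0 1 ≤
      ENNReal.ofReal (Real.exp (rate ψ)) * ENNReal.ofReal (Real.exp (3 / 2 * ψ ^ 2 * u ^ 2)) := by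
  have hrate := six_mul_sq_le_rate hψ
  have hp : ρ ^ 2 ≤ ψ ^ 2 := sq_le_sq.2 hρ
  have hr : ψ ^ 2 ≤ 1 / 81 := by
    rw [← sq_abs]
    nlinarith [abs_nonneg ψ]
  have hp0 := sq_nonneg ρ
  set r := ψ ^ 2
  have h1 : 0 < 1 - ρ ^ 2 := by linarith
  set p := ρ ^ 2 with hpdef
  have hD : 0 < 1 + p - 3 * r * (1 - p) := by nlinarith
  have hq : 0 < (1 + p - 3 * r * (1 - p)) / (1 - p) := by positivity
  have key : ∀ y, mehler ρ u y ^ 2 * ENNReal.ofReal (Real.exp (3 / 2 * r * y ^ 2)) =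
      ENNReal.ofReal ((1 - p)⁻¹ *
        Real.exp (-((1 + p - 3 * r * (1 - p)) / (1 - p) - 1) / 2 * y ^ 2 +
          (2 * ρ * u / (1 - p)) * y + (-p * u ^ 2 / (1 - p)))) := by
    intro y
    rw [mehler, ← ENNReal.ofReal_pow (by positivity), ← ENNReal.ofReal_mul (by positivity),
      mul_pow, inv_pow, Real.sq_sqrt h1.le, ← Real.exp_nat_mul, mul_assoc, ← Real.exp_add]
    congr 3
    rw [← hpdef]
    push_cast
    field_simp
    ring
  rw [lintegral_congr key, lintegral_exp_quadratic_gaussianReal (by positivity) hq,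
    ← ENNReal.ofReal_mul (by positivity)]
  apply ENNReal.ofReal_le_ofReal
  gcongr
  · have h2 : (1 - p)⁻¹ * (Real.sqrt ((1 + p - 3 * r * (1 - p)) / (1 - p)))⁻¹ =
        (Real.sqrt ((1 - p) * (1 + p - 3 * r * (1 - p))))⁻¹ := by
      rw [Real.sqrt_div' _ h1.le, Real.sqrt_mul h1.le]
      have h3 := (Real.sqrt_pos.2 h1).ne'
      have h5 := (Real.sqrt_pos.2 hD).ne'
      field_simp
      rw [Real.sq_sqrt h1.le]
    rw [h2]
    -- the squared prefactor is at most `(1 - 4 r)⁻¹`, hence at most `exp (12 r) ≤ exp (2 λ(ψ))`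
    have h6 : 1 - 4 * r ≤ (1 - p) * (1 + p - 3 * r * (1 - p)) := by
      have h10 : p ^ 2 ≤ r := by nlinarith
      have h11 : r * (1 - p) ^ 2 ≤ r * 1 := by
        gcongr
        nlinarith
      nlinarith
    have h7 : Real.exp (-(12 * r)) ≤ 1 - 4 * r := by
      rw [Real.exp_neg]
      have h8 := Real.add_one_le_exp (12 * r)
      have hr0 : 0 ≤ r := hp0.trans hp
      rw [inv_le_comm₀ (Real.exp_pos _) (by linarith)]
      refine le_trans ?_ h8
      rw [inv_le_iff_one_le_mul₀ (by linarith)]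
      nlinarith
    rw [inv_le_comm₀ (Real.sqrt_pos.2 (by positivity)) (Real.exp_pos _), ← Real.exp_neg]
    apply Real.le_sqrt_of_sq_le
    rw [← Real.exp_nat_mul]
    refine le_trans (Real.exp_le_exp.2 ?_) (h7.trans h6)
    push_cast
    linarith
  · have h9 : (2 * ρ * u / (1 - p)) ^ 2 / (2 * ((1 + p - 3 * r * (1 - p)) / (1 - p))) +
        -p * u ^ 2 / (1 - p) = p * (1 + 3 * r) / (1 + p - 3 * r * (1 - p)) * u ^ 2 := by
      rw [div_pow, mul_pow, mul_pow, ← hpdef]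
      generalize hDdef : 1 + p - 3 * r * (1 - p) = D at hD
      field_simp
      rw [← hDdef]
      ring
    rw [h9]
    gcongr
    rw [div_le_iff₀ hD]
    have hr0 : 0 ≤ r := hp0.trans hp
    calc p * (1 + 3 * r) ≤ r * (1 + 3 * r) := by gcongr
      _ ≤ r * (3 / 2 * (1 + p - 3 * r * (1 - p))) := by
          gcongr
          nlinarith
      _ = _ := by ring

/-! ### Resampling one coordinate of white noise -/

instance : IsProbabilityMeasure (nullLaw V) := by
  unfold nullLaw
  infer_instance

open Classical in
theorem measurable_update_uncurry (i : V) :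
    Measurable fun p : (V → ℝ) × ℝ => Function.update p.1 i p.2 := by
  refine measurable_pi_lambda _ fun j => ?_
  by_cases h : j = i
  · subst h
    simpa using measurable_snd
  · simp only [Function.update_of_ne h]
    fun_prop

open Classical in
theorem map_update_nullLaw (i : V) :
    ((nullLaw V).prod (gaussianReal 0 1)).map (fun p => Function.update p.1 i p.2) =
      nullLaw V := by
  refine Measure.eq_infinitePi _ fun s t ht => ?_
  rw [Measure.map_apply (measurable_update_uncurry i) (MeasurableSet.pi s.countable_toSet
    fun j _ => ht j)]
  have hpre : (fun p : (V → ℝ) × ℝ => Function.update p.1 i p.2) ⁻¹' Set.pi s t =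
      (Set.pi (s.erase i : Finset V) t) ×ˢ (if i ∈ s then t i else Set.univ) := by
    ext ⟨x, y⟩
    simp only [Set.mem_preimage, Set.mem_pi, Set.mem_prod, Finset.mem_coe, Finset.mem_erase]
    constructor
    · intro h
      refine ⟨fun j hj => by simpa [hj.1] using h j hj.2, ?_⟩
      split_ifs with hi
      · simpa using h i hi
      · trivial
    · rintro ⟨h1, h2⟩ j hj
      by_cases hji : j = i
      · subst hji
        simpa [hj] using h2
      · simpa [hji] using h1 j ⟨hji, hj⟩
  rw [hpre, Measure.prod_prod, nullLaw, Measure.infinitePi_pi _ fun j _ => ht j]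
  split_ifs with hi
  · rw [mul_comm, Finset.mul_prod_erase s (fun j => gaussianReal 0 1 (t j)) hi]
  · simp [Finset.erase_eq_of_notMem hi]

open Classical in
/-- Fubini for one coordinate of the (possibly uncountable) product: an integral under white noise
does not change when a coordinate is first integrated out. -/
theorem lintegral_nullLaw_update (i : V) {F : (V → ℝ) → ℝ≥0∞} (hF : Measurable F) :
    ∫⁻ x, F x ∂nullLaw V =
      ∫⁻ x, ∫⁻ y, F (Function.update x i y) ∂gaussianReal 0 1 ∂nullLaw V := by
  conv_lhs => rw [← map_update_nullLaw i]
  rw [lintegral_map hF (measurable_update_uncurry i)]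
  exact lintegral_prod _ (hF.comp (measurable_update_uncurry i)).aemeasurable

open Classical in
/-- `F` does not depend on the coordinate `i`. -/
def IndepOf {β : Type*} (F : (V → ℝ) → β) (i : V) : Prop :=
  ∀ x y, F (Function.update x i y) = F x

open Classical in
theorem indepOf_eval {i j : V} (h : j ≠ i) : IndepOf (fun x : V → ℝ => x j) i :=
  fun x y => Function.update_of_ne h y x

theorem IndepOf.mul {F G : (V → ℝ) → ℝ≥0∞} {i : V} (hF : IndepOf F i) (hG : IndepOf G i) :
    IndepOf (fun x => F x * G x) i := fun x y => by
  simp only [hF x y, hG x y]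

/-! ### The likelihood ratio of a path -/

/-- The likelihood ratio, with respect to white noise, of an autoregression along `l` that starts
from the value `u`, has coefficient `ρ` in its first step and `ψ` in the later ones. The choice
`ρ = 0` makes the first variable of `l` standard normal. -/
noncomputable def chainLik (ψ : ℝ) : ℝ → ℝ → List V → (V → ℝ) → ℝ≥0∞
  | _, _, [], _ => 1
  | ρ, u, b :: l, x => mehler ρ u (x b) * chainLik ψ ψ (x b) l x

theorem measurable_chainLik (ψ : ℝ) (l : List V) : ∀ (ρ : ℝ) {u : (V → ℝ) → ℝ}, Measurable u →
    Measurable fun x => chainLik ψ ρ (u x) l x := by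
  induction l with
  | nil => intro ρ u _; exact measurable_const
  | cons b l ih =>
    intro ρ u hu
    exact (measurable_mehler ρ hu (measurable_pi_apply b)).mul (ih ψ (measurable_pi_apply b))

theorem indepOf_chainLik (ψ : ℝ) {v : V} (l : List V) : ∀ (ρ : ℝ) {u : (V → ℝ) → ℝ},
    IndepOf u v → v ∉ l → IndepOf (fun x => chainLik ψ ρ (u x) l x) v := by
  induction l with
  | nil => intro ρ u _ _ x y; rfl
  | cons b l ih =>
    intro ρ u hu hv x y
    rw [List.mem_cons, not_or] at hv
    have hb := indepOf_eval (Ne.symm hv.1)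
    have h1 := ih ψ hb hv.2 x y
    have h2 := hb x y
    simp only at h2
    simp only [h2] at h1
    simp only [chainLik, hu x y, h1, h2]

open Classical in
theorem arMap_apply_of_notMem_tail (ψ : ℝ) {v : V} :
    ∀ (l : List V) (a : V) (z : V → ℝ), v ∉ l → arMap ψ (a :: l) z v = z v
  | [], _, _, _ => rfl
  | b :: l, a, z, hv => by
    rw [List.mem_cons, not_or] at hv
    rw [arMap, arMap_apply_of_notMem_tail ψ l b _ hv.2, Function.update_of_ne hv.1]

/-- Change of measure for a whole path, one autoregressive step at a time. -/
theorem lintegral_arMap {ψ : ℝ} (hψ : |ψ| < 1) (l : List V) : ∀ (a : V), (a :: l).Nodup →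
    ∀ {F : (V → ℝ) → ℝ≥0∞}, Measurable F →
    ∫⁻ z, F (arMap ψ (a :: l) z) ∂nullLaw V =
      ∫⁻ x, chainLik ψ ψ (x a) l x * F x ∂nullLaw V := by
  classical
  induction l with
  | nil => intro a _ F _; simp [arMap, chainLik]
  | cons b l ih =>
    intro a hnd F hF
    obtain ⟨ha, hnd'⟩ := List.nodup_cons.1 hnd
    have hab : a ≠ b := fun h => ha (h ▸ List.mem_cons_self)
    have hal : a ∉ l := fun h => ha (List.mem_cons_of_mem _ h)
    have hbl : b ∉ l := (List.nodup_cons.1 hnd').1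
    have hG : Measurable fun z => F (arMap ψ (b :: l) z) := hF.comp (measurable_arMap ψ _)
    have hk : Measurable fun x : V → ℝ => mehler ψ (x a) (x b) :=
      measurable_mehler ψ (measurable_pi_apply a) (measurable_pi_apply b)
    calc ∫⁻ z, F (arMap ψ (a :: b :: l) z) ∂nullLaw V
        = ∫⁻ z, ∫⁻ y, F (arMap ψ (b :: l) (Function.update z b
            (ψ * z a + Real.sqrt (1 - ψ ^ 2) * y))) ∂gaussianReal 0 1 ∂nullLaw V := by
          rw [lintegral_nullLaw_update b (F := fun z => F (arMap ψ (a :: b :: l) z))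
            (hF.comp (measurable_arMap ψ (a :: b :: l)))]
          refine lintegral_congr fun z => lintegral_congr fun y => ?_
          simp [arMap, Function.update_of_ne hab]
      _ = ∫⁻ z, ∫⁻ y, mehler ψ (z a) y * F (arMap ψ (b :: l) (Function.update z b y))
            ∂gaussianReal 0 1 ∂nullLaw V := by
          refine lintegral_congr fun z => ?_
          exact lintegral_autoregressive_step hψ (z a)
            (G := fun y => F (arMap ψ (b :: l) (Function.update z b y)))
            (hG.comp (measurable_update z))
      _ = ∫⁻ z, mehler ψ (z a) (z b) * F (arMap ψ (b :: l) z) ∂nullLaw V := by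
          rw [lintegral_nullLaw_update b
            (F := fun z => mehler ψ (z a) (z b) * F (arMap ψ (b :: l) z)) (hk.mul hG)]
          simp [Function.update_of_ne hab]
      _ = ∫⁻ z, (fun x => mehler ψ (x a) (x b) * F x) (arMap ψ (b :: l) z) ∂nullLaw V := by
          refine lintegral_congr fun z => ?_
          simp only [arMap_apply_of_notMem_tail ψ l b z hal,
            arMap_apply_of_notMem_tail ψ l b z hbl]
      _ = _ := by
          rw [ih b hnd' (F := fun x => mehler ψ (x a) (x b) * F x) (hk.mul hF)]
          refine lintegral_congr fun x => ?_
          simp only [chainLik]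
          ring

/-- The likelihood ratio of the path `s`. -/
noncomputable def pathLik (ψ : ℝ) (s : List V) (x : V → ℝ) : ℝ≥0∞ :=
  chainLik ψ 0 0 s x

theorem measurable_pathLik (ψ : ℝ) (s : List V) : Measurable (pathLik ψ s) :=
  measurable_chainLik ψ s 0 measurable_const

theorem altLaw_eq_withDensity {ψ : ℝ} (hψ : |ψ| < 1) {s : List V} (hne : s ≠ [])
    (hnd : s.Nodup) : altLaw ψ s = (nullLaw V).withDensity (pathLik ψ s) := by
  obtain ⟨a, l, rfl⟩ := List.exists_cons_of_ne_nil hne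
  ext A hA
  rw [withDensity_apply _ hA, ← lintegral_indicator hA, ← lintegral_indicator_one hA, altLaw,
    lintegral_map (measurable_one.indicator hA) (measurable_arMap ψ _),
    lintegral_arMap hψ l a hnd (measurable_one.indicator hA)]
  refine lintegral_congr fun x => ?_
  by_cases hx : x ∈ A <;> simp [hx, pathLik, chainLik, mehler_zero]

/-! ### Marginal likelihood ratios -/

open Classical in
/-- The marginal likelihood ratio of the chain on the nodes of `I`: the variables off `I` are
integrated out, so that a step across a stretch of skipped nodes has the product of their
coefficients. -/
noncomputable def margLik (ψ : ℝ) (I : Set V) : ℝ → ℝ → List V → (V → ℝ) → ℝ≥0∞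
  | _, _, [], _ => 1
  | ρ, u, b :: l, x =>
      if b ∈ I then mehler ρ u (x b) * margLik ψ I ψ (x b) l x
      else margLik ψ I (ρ * ψ) u l x

theorem measurable_margLik (ψ : ℝ) (I : Set V) (l : List V) : ∀ (ρ : ℝ) {u : (V → ℝ) → ℝ},
    Measurable u → Measurable fun x => margLik ψ I ρ (u x) l x := by
  induction l with
  | nil => intro ρ u _; exact measurable_const
  | cons b l ih =>
    intro ρ u hu
    by_cases hb : b ∈ I
    · simp only [margLik, hb, if_true]
      exact (measurable_mehler ρ hu (measurable_pi_apply b)).mul (ih ψ (measurable_pi_apply b))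
    · simp only [margLik, hb, if_false]
      exact ih _ hu

theorem indepOf_margLik (ψ : ℝ) (I : Set V) {v : V} (l : List V) :
    ∀ (ρ : ℝ) {u : (V → ℝ) → ℝ}, IndepOf u v → v ∉ l →
      IndepOf (fun x => margLik ψ I ρ (u x) l x) v := by
  induction l with
  | nil => intro ρ u _ _ x y; rfl
  | cons b l ih =>
    intro ρ u hu hv x y
    rw [List.mem_cons, not_or] at hv
    by_cases hb : b ∈ I
    · have hbv := indepOf_eval (Ne.symm hv.1)
      have h1 := ih ψ hbv hv.2 x y
      have h2 := hbv x y
      simp only at h2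
      simp only [h2] at h1
      simp only [margLik, hb, if_true, hu x y, h1, h2]
    · simp only [margLik, hb, if_false]
      exact ih _ hu hv.2 x y

open Classical in
/-- Integrating out the first node of a chain merges its two adjacent steps into one. -/
theorem lintegral_chainLik_update {ψ : ℝ} (hψ : |ψ| < 1) {ρ : ℝ} (hρ : |ρ| < 1) (u : ℝ) {b : V}
    {l : List V} (hnd : (b :: l).Nodup) (x : V → ℝ) :
    ∫⁻ y, mehler ρ u y * chainLik ψ ψ y l (Function.update x b y) ∂gaussianReal 0 1 =
      chainLik ψ (ρ * ψ) u l x := by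
  cases l with
  | nil => simpa [chainLik] using lintegral_mehler hρ u
  | cons d l =>
    have hb := (List.nodup_cons.1 hnd).1
    rw [List.mem_cons, not_or] at hb
    have hdb : d ≠ b := Ne.symm hb.1
    have h : ∀ y, mehler ρ u y * chainLik ψ ψ y (d :: l) (Function.update x b y) =
        mehler ρ u y * mehler ψ y (x d) * chainLik ψ ψ (x d) l x := by
      intro y
      have h1 := indepOf_chainLik ψ l ψ (indepOf_eval hdb) hb.2 x y
      simp only at h1
      rw [chainLik, h1, Function.update_of_ne hdb, mul_assoc]
    have hm : Measurable fun y => mehler ρ u y * mehler ψ y (x d) :=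
      (measurable_mehler ρ measurable_const measurable_id).mul
        (measurable_mehler ψ measurable_id measurable_const)
    rw [lintegral_congr h, lintegral_mul_const _ hm, lintegral_mehler_mul_mehler hρ hψ, chainLik]

/-- The marginal likelihood ratio is the conditional expectation of the likelihood ratio: both have
the same integral against functions that do not depend on the nodes of the chain off `I`. -/
theorem lintegral_mul_chainLik {ψ : ℝ} (hψ : |ψ| < 1) (I : Set V) (l : List V) :
    ∀ {ρ : ℝ}, |ρ| < 1 → l.Nodup → ∀ {u : (V → ℝ) → ℝ}, Measurable u → (∀ v ∈ l, IndepOf u v) →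
    ∀ {g : (V → ℝ) → ℝ≥0∞}, Measurable g → (∀ v ∈ l, v ∉ I → IndepOf g v) →
    ∫⁻ x, g x * chainLik ψ ρ (u x) l x ∂nullLaw V =
      ∫⁻ x, g x * margLik ψ I ρ (u x) l x ∂nullLaw V := by
  classical
  induction l with
  | nil => intros; rfl
  | cons b l ih =>
    intro ρ hρ hnd u hu hul g hg hgl
    obtain ⟨hbl, hnd'⟩ := List.nodup_cons.1 hnd
    have hne : ∀ v ∈ l, b ≠ v := fun v hv h => hbl (h ▸ hv)
    have hk : Measurable fun x : V → ℝ => mehler ρ (u x) (x b) :=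
      measurable_mehler ρ hu (measurable_pi_apply b)
    by_cases hb : b ∈ I
    · have h := ih hψ hnd' (measurable_pi_apply b) (fun v hv => indepOf_eval (hne v hv))
        (hg.mul hk) (fun v hv hvI => (hgl v (List.mem_cons_of_mem _ hv) hvI).mul fun x y => by
          have h1 := hul v (List.mem_cons_of_mem _ hv) x y
          simp only [h1, Function.update_of_ne (hne v hv)])
      simpa only [chainLik, margLik, hb, if_true, Pi.mul_apply, mul_assoc] using h
    · simp only [margLik, hb, if_false]
      have hρψ : |ρ * ψ| < 1 := by
        rw [abs_mul]
        exact mul_lt_one_of_nonneg_of_lt_one_left (abs_nonneg _) hρ hψ.le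
      rw [← ih hρψ hnd' hu (fun v hv => hul v (List.mem_cons_of_mem _ hv)) hg
        (fun v hv hvI => hgl v (List.mem_cons_of_mem _ hv) hvI),
        lintegral_nullLaw_update b (F := fun x => g x * chainLik ψ ρ (u x) (b :: l) x)
          (hg.mul (measurable_chainLik ψ _ ρ hu))]
      refine lintegral_congr fun x => ?_
      have hgb := hgl b List.mem_cons_self hb x
      have hub := hul b List.mem_cons_self x
      have h : ∀ y, (fun x => g x * chainLik ψ ρ (u x) (b :: l) x) (Function.update x b y) =
          g x * (mehler ρ (u x) y * chainLik ψ ψ y l (Function.update x b y)) := by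
        intro y
        simp only [hgb, hub, chainLik, Function.update_self]
      rw [lintegral_congr h, lintegral_const_mul, lintegral_chainLik_update hψ hρ _ hnd]
      refine (measurable_mehler ρ measurable_const measurable_id).mul ?_
      have h2 := (measurable_chainLik ψ l ψ (measurable_pi_apply b)).comp
        (measurable_update (a := b) x)
      simpa [Function.comp_def] using h2

/-! ### Second moments and correlations of likelihood ratios -/

open Classical in
/-- The second moment of a marginal likelihood ratio grows at most by the factor `exp (λ(ψ))` with
each node of `I` on the chain. -/
theorem lintegral_margLik_sq_le {ψ : ℝ} (hψ : |ψ| < 1 / 9) (I : Set V) (l : List V) :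
    ∀ {ρ : ℝ}, |ρ| ≤ |ψ| → l.Nodup → ∀ {u : (V → ℝ) → ℝ}, Measurable u → (∀ v ∈ l, IndepOf u v) →
    ∀ {g : (V → ℝ) → ℝ≥0∞}, Measurable g → (∀ v ∈ l, IndepOf g v) →
    ∫⁻ x, g x * margLik ψ I ρ (u x) l x ^ 2 ∂nullLaw V ≤
      ENNReal.ofReal (Real.exp (rate ψ)) ^ (l.filter (· ∈ I)).length *
        ∫⁻ x, g x * ENNReal.ofReal (Real.exp (3 / 2 * ψ ^ 2 * u x ^ 2)) ∂nullLaw V := by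
  induction l with
  | nil =>
    intro ρ hρ _ u hu _ g hg _
    simp only [margLik, List.filter_nil, List.length_nil, pow_zero, one_mul, one_pow]
    refine lintegral_mono fun x => ?_
    dsimp only
    gcongr
    rw [ENNReal.one_le_ofReal]
    exact Real.one_le_exp (by positivity)
  | cons b l ih =>
    intro ρ hρ hnd u hu hul g hg hgl
    obtain ⟨hbl, hnd'⟩ := List.nodup_cons.1 hnd
    have hne : ∀ v ∈ l, b ≠ v := fun v hv h => hbl (h ▸ hv)
    by_cases hb : b ∈ I
    · have hk : Measurable fun x : V → ℝ => mehler ρ (u x) (x b) ^ 2 :=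
        (measurable_mehler ρ hu (measurable_pi_apply b)).pow_const 2
      have h := ih le_rfl hnd' (measurable_pi_apply b) (fun v hv => indepOf_eval (hne v hv))
        (hg.mul hk) (fun v hv => (hgl v (List.mem_cons_of_mem _ hv)).mul fun x y => by
          have h1 := hul v (List.mem_cons_of_mem _ hv) x y
          simp only [h1, Function.update_of_ne (hne v hv)])
      have hw : Measurable fun x : V → ℝ =>
          ENNReal.ofReal (Real.exp (3 / 2 * ψ ^ 2 * x b ^ 2)) := by fun_prop
      have hstep : ∫⁻ x, (g x * mehler ρ (u x) (x b) ^ 2) *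
          ENNReal.ofReal (Real.exp (3 / 2 * ψ ^ 2 * x b ^ 2)) ∂nullLaw V ≤
          ENNReal.ofReal (Real.exp (rate ψ)) *
            ∫⁻ x, g x * ENNReal.ofReal (Real.exp (3 / 2 * ψ ^ 2 * u x ^ 2)) ∂nullLaw V := by
        rw [lintegral_nullLaw_update b (F := fun x => (g x * mehler ρ (u x) (x b) ^ 2) *
          ENNReal.ofReal (Real.exp (3 / 2 * ψ ^ 2 * x b ^ 2))) ((hg.mul hk).mul hw),
          ← lintegral_const_mul' _ _ ENNReal.ofReal_ne_top]
        refine lintegral_mono fun x => ?_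
        have hgb := hgl b List.mem_cons_self x
        have hub := hul b List.mem_cons_self x
        have he : ∀ y, (fun x => (g x * mehler ρ (u x) (x b) ^ 2) *
            ENNReal.ofReal (Real.exp (3 / 2 * ψ ^ 2 * x b ^ 2))) (Function.update x b y) =
            g x * (mehler ρ (u x) y ^ 2 *
              ENNReal.ofReal (Real.exp (3 / 2 * ψ ^ 2 * y ^ 2))) := by
          intro y
          simp only [hgb, hub, Function.update_self, mul_assoc]
        have hm : Measurable fun y => mehler ρ (u x) y ^ 2 *
            ENNReal.ofReal (Real.exp (3 / 2 * ψ ^ 2 * y ^ 2)) :=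
          ((measurable_mehler ρ measurable_const measurable_id).pow_const 2).mul (by fun_prop)
        rw [lintegral_congr he, lintegral_const_mul _ hm, mul_left_comm]
        gcongr
        exact lintegral_mehler_sq_le hψ hρ (u x)
      simp only [margLik, hb, if_true, decide_true, List.filter_cons_of_pos, List.length_cons]
      rw [pow_succ, mul_assoc]
      refine le_trans (le_of_eq ?_) (h.trans (mul_le_mul_right hstep _))
      refine lintegral_congr fun x => ?_
      simp only [Pi.mul_apply]
      ring
    · have hρψ : |ρ * ψ| ≤ |ψ| := by
        rw [abs_mul]
        nlinarith [abs_nonneg ρ, abs_nonneg ψ]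
      simp only [margLik, hb, if_false, decide_false, List.filter_cons_of_neg, Bool.false_eq_true,
        not_false_eq_true]
      exact ih hρψ hnd' hu (fun v hv => hul v (List.mem_cons_of_mem _ hv)) hg
        (fun v hv => hgl v (List.mem_cons_of_mem _ hv))

open Classical in
theorem length_filter_mem {s : List V} (hs : s.Nodup) (I : Set V) :
    (s.filter (· ∈ I)).length = ({v | v ∈ s} ∩ I).ncard := by
  rw [← List.toFinset_card_of_nodup (hs.filter _), ← Set.ncard_coe_finset]
  congr 1
  ext v
  simp

theorem ennreal_two_mul_le_add_sq (a b : ℝ≥0∞) : 2 * (a * b) ≤ a ^ 2 + b ^ 2 := by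
  wlog h : a ≤ b generalizing a b
  · rw [mul_comm a b, add_comm]
    exact this b a (le_of_not_ge h)
  · obtain ⟨c, rfl⟩ := exists_add_of_le h
    calc 2 * (a * (a + c)) ≤ 2 * (a * (a + c)) + c ^ 2 := le_self_add
      _ = a ^ 2 + (a + c) ^ 2 := by ring

theorem overlap_comm (s t : List V) : overlap s t = overlap t s := by
  rw [overlap, overlap, Set.inter_comm]

theorem lintegral_margLik_start_sq_le {ψ : ℝ} (hψ : |ψ| < 1 / 9) {s : List V} (hs : s.Nodup)
    (t : List V) :
    ∫⁻ x, margLik ψ {v | v ∈ t} 0 0 s x ^ 2 ∂nullLaw V ≤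
      ENNReal.ofReal (Real.exp (rate ψ * overlap s t)) := by
  have h := lintegral_margLik_sq_le hψ {v | v ∈ t} s (ρ := 0) (by simp) hs (u := fun _ => 0)
    measurable_const (fun _ _ _ _ => rfl) (g := fun _ => 1) measurable_const
    (fun _ _ _ _ => rfl)
  rw [length_filter_mem hs, ← overlap] at h
  rw [mul_comm (rate ψ), Real.exp_nat_mul, ENNReal.ofReal_pow (Real.exp_pos _).le]
  simpa using h

/-- The correlation of two likelihood ratios. Given the common variables, those of one path are
independent of those of the other, so both likelihood ratios can be replaced by their marginals on
the common nodes. -/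
theorem lintegral_pathLik_mul_pathLik_le {ψ : ℝ} (hψ : |ψ| < 1 / 9) {s t : List V}
    (hs : s.Nodup) (ht : t.Nodup) :
    ∫⁻ x, pathLik ψ s x * pathLik ψ t x ∂nullLaw V ≤
      ENNReal.ofReal (Real.exp (rate ψ * overlap s t)) := by
  have hψ1 : |ψ| < 1 := hψ.trans (by norm_num)
  have hst : ∫⁻ x, pathLik ψ s x * pathLik ψ t x ∂nullLaw V =
      ∫⁻ x, margLik ψ {v | v ∈ t} 0 0 s x * margLik ψ {v | v ∈ s} 0 0 t x ∂nullLaw V := by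
    have h1 := lintegral_mul_chainLik hψ1 {v | v ∈ t} s (ρ := 0) (by simp) hs (u := fun _ => 0)
      measurable_const (fun _ _ _ _ => rfl) (measurable_pathLik ψ t)
      (fun v _ hv => indepOf_chainLik ψ t 0 (fun _ _ => rfl) hv)
    have h2 := lintegral_mul_chainLik hψ1 {v | v ∈ s} t (ρ := 0) (by simp) ht (u := fun _ => 0)
      measurable_const (fun _ _ _ _ => rfl)
      (measurable_margLik ψ {v | v ∈ t} s 0 (u := fun _ => 0) measurable_const)
      (fun v _ hv => indepOf_margLik ψ _ s 0 (fun _ _ => rfl) hv)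
    simp only [pathLik] at h1 ⊢
    rw [← h2]
    simpa only [mul_comm] using h1
  rw [hst]
  have hm1 := measurable_margLik ψ {v | v ∈ t} s 0 (u := fun _ => 0) measurable_const
  have hm2 := measurable_margLik ψ {v | v ∈ s} t 0 (u := fun _ => 0) measurable_const
  have hs2 := lintegral_margLik_start_sq_le hψ hs t
  have ht2 := lintegral_margLik_start_sq_le hψ ht s
  rw [overlap_comm t s] at ht2
  have h2 : 2 * ∫⁻ x, margLik ψ {v | v ∈ t} 0 0 s x * margLik ψ {v | v ∈ s} 0 0 t x ∂nullLaw V ≤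
      2 * ENNReal.ofReal (Real.exp (rate ψ * overlap s t)) := by
    rw [← lintegral_const_mul' _ _ ENNReal.ofNat_ne_top, two_mul (ENNReal.ofReal _)]
    refine le_trans (lintegral_mono fun x => ennreal_two_mul_le_add_sq _ _) ?_
    rw [lintegral_add_left (hm1.pow_const 2)]
    exact add_le_add hs2 ht2
  exact (ENNReal.mul_le_mul_iff_right two_ne_zero ENNReal.ofNat_ne_top).1 h2

/-! ### Testing against a mixture -/

/-- The second-moment lower bound for testing a probability measure `P` against `L · P`: the sum of
the error probabilities of any test is at least `1` minus the total variation distance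
`(1 / 2) ∫ |L - 1| dP`, which the Cauchy–Schwarz inequality bounds. -/
theorem one_le_add_lintegral_add_sqrt {Ω : Type*} [MeasurableSpace Ω] (P : Measure Ω)
    [IsProbabilityMeasure P] {L : Ω → ℝ≥0∞} (hL : Measurable L) (h1 : ∫⁻ x, L x ∂P = 1)
    {A : Set Ω} (hA : MeasurableSet A) :
    1 ≤ P A + ∫⁻ x in Aᶜ, L x ∂P +
      (1 / 2) * ((∫⁻ x, L x ^ 2 ∂P) - 1) ^ (1 / 2 : ℝ) := by
  set M := ∫⁻ x, L x ^ 2 ∂P with hM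
  by_cases hfin : M = ∞
  · rw [hfin, ENNReal.top_sub ENNReal.one_ne_top, ENNReal.top_rpow_of_pos (by norm_num),
      ENNReal.mul_top (by simp), add_top]
    exact le_top
  have hLae : ∀ᵐ x ∂P, L x < ∞ := ae_lt_top hL (by simp [h1])
  have hint : Integrable (fun x => (L x).toReal) P :=
    integrable_toReal_of_lintegral_ne_top hL.aemeasurable (by simp [h1])
  have hint1 : ∫ x, (L x).toReal ∂P = 1 := by
    rw [integral_toReal hL.aemeasurable hLae, h1, ENNReal.toReal_one]
  have hint2 : ∫ x, (L x).toReal ^ 2 ∂P = M.toReal := by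
    rw [hM, ← integral_toReal (hL.pow_const 2).aemeasurable
      (hLae.mono fun x hx => ENNReal.pow_lt_top hx)]
    simp only [ENNReal.toReal_pow]
  have hsq : Integrable (fun x => (L x).toReal ^ 2) P := by
    have := integrable_toReal_of_lintegral_ne_top (hL.pow_const 2).aemeasurable hfin
    simpa only [ENNReal.toReal_pow] using this
  have hd : Integrable (fun x => (L x).toReal - 1) P := hint.sub (integrable_const 1)
  have hdsq : ∫ x, ((L x).toReal - 1) ^ 2 ∂P = M.toReal - 1 := by
    have h : ∀ x, ((L x).toReal - 1) ^ 2 = (L x).toReal ^ 2 - (2 * (L x).toReal - 1) := by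
      intro x
      ring
    have hlin : Integrable (fun x => 2 * (L x).toReal - 1) P :=
      (hint.const_mul 2).sub (integrable_const 1)
    simp only [h]
    rw [integral_sub hsq hlin,
      integral_sub (hint.const_mul 2) (integrable_const 1), integral_const_mul, hint1, hint2]
    simp
    ring
  have hCS : (∫ x, |(L x).toReal - 1| ∂P) ^ 2 ≤ M.toReal - 1 := by
    have hmem : MemLp (fun x => |(L x).toReal - 1|) 2 P := by
      refine (memLp_two_iff_integrable_sq hd.abs.aestronglyMeasurable).2 ?_
      simp only [sq_abs]
      have h : (fun x => ((L x).toReal - 1) ^ 2) =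
          fun x => (L x).toReal ^ 2 - (2 * (L x).toReal - 1) := by
        ext x
        ring
      rw [h]
      exact hsq.sub ((hint.const_mul 2).sub (integrable_const 1))
    have hv := variance_eq_sub hmem
    have hv0 := variance_nonneg (fun x => |(L x).toReal - 1|) P
    simp only [Pi.pow_apply, sq_abs, hdsq] at hv
    linarith
  have hM1 : 1 ≤ M.toReal := by nlinarith [sq_nonneg (∫ x, |(L x).toReal - 1| ∂P)]
  have hM1' : 1 ≤ M := by
    rwa [← ENNReal.toReal_one, ENNReal.toReal_le_toReal ENNReal.one_ne_top hfin] at hM1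
  -- `L - 1` has integral `0`, so its integral over `Aᶜ` is at least `-(1 / 2) ∫ |L - 1|`
  have habs := Real.le_sqrt_of_sq_le hCS
  have hsplit := integral_add_compl hA hd
  have hsplit' := integral_add_compl hA hd.abs
  have h0 : ∫ x, ((L x).toReal - 1) ∂P = 0 := by
    rw [integral_sub hint (integrable_const 1), hint1]
    simp
  have hA1 : ∫ x in A, ((L x).toReal - 1) ∂P ≤ ∫ x in A, |(L x).toReal - 1| ∂P :=
    (le_abs_self _).trans (abs_integral_le_integral_abs)
  have hA2 : -∫ x in Aᶜ, ((L x).toReal - 1) ∂P ≤ ∫ x in Aᶜ, |(L x).toReal - 1| ∂P :=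
    (neg_le_abs _).trans (abs_integral_le_integral_abs)
  have hAc : ∫ x in Aᶜ, ((L x).toReal - 1) ∂P =
      (∫⁻ x in Aᶜ, L x ∂P).toReal - (1 - (P A).toReal) := by
    rw [integral_sub hint.integrableOn (integrable_const 1).integrableOn,
      integral_toReal hL.aemeasurable (ae_restrict_of_ae hLae)]
    rw [setIntegral_const, probReal_compl_eq_one_sub hA, measureReal_def, smul_eq_mul, mul_one]
  have hLA : ∫⁻ x in Aᶜ, L x ∂P ≠ ∞ :=
    ((setLIntegral_le_lintegral _ _).trans_lt (by simp [h1])).ne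
  have hroot : (M - 1) ^ (1 / 2 : ℝ) ≠ ∞ :=
    ENNReal.rpow_ne_top_of_nonneg (by norm_num) (ENNReal.sub_ne_top hfin)
  rw [← ENNReal.toReal_le_toReal ENNReal.one_ne_top (by finiteness), ENNReal.toReal_add
    (by finiteness) (by finiteness), ENNReal.toReal_add (by finiteness) hLA, ENNReal.toReal_mul,
    ← ENNReal.toReal_rpow, ENNReal.toReal_sub_of_le hM1' hfin, ENNReal.toReal_one,
    ← Real.sqrt_eq_rpow]
  norm_num
  linarith

/-- The lower bound for a single test. All series are restricted to the support of `ν`, which is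
countable even when the class of paths is not. -/
theorem one_le_avgRisk_add {C : Set (List V)} (hne : ∀ s ∈ C, s ≠ []) (hnd : ∀ s ∈ C, s.Nodup)
    (ν : PMF C) {ψ : ℝ} (hψ : |ψ| < 1 / 9) {f : (V → ℝ) → Fin 2} (hf : Measurable f) :
    1 ≤ avgRisk ν ψ f + (1 / 2) * (expOverlap ν (rate ψ) - 1) ^ (1 / 2 : ℝ) := by
  have hψ1 : |ψ| < 1 := hψ.trans (by norm_num)
  have : Countable ν.support := ν.support_countable.to_subtype
  have hA : MeasurableSet {x | f x = 1} := hf (measurableSet_singleton 1)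
  have hAc : {x | f x = 1}ᶜ = {x | f x = 0} := by
    ext x
    simp only [Set.mem_compl_iff, Set.mem_ofPred_eq]
    omega
  have hmeas : ∀ s : ν.support, Measurable fun x => ν s * pathLik ψ (s : List V) x :=
    fun s => (measurable_pathLik ψ _).const_mul _
  have hdens : ∀ s : ν.support, ∀ B : Set (V → ℝ), MeasurableSet B →
      ∫⁻ x in B, ν s * pathLik ψ (s : List V) x ∂nullLaw V = ν s * altLaw ψ (s : List V) B := by
    intro s B hB
    rw [lintegral_const_mul _ (measurable_pathLik ψ _),
      altLaw_eq_withDensity hψ1 (hne _ s.1.2) (hnd _ s.1.2), withDensity_apply _ hB]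
  set L : (V → ℝ) → ℝ≥0∞ := fun x => ∑' s : ν.support, ν s * pathLik ψ (s : List V) x with hLdef
  have hL : Measurable L := Measurable.tsum hmeas
  have hL1 : ∫⁻ x, L x ∂nullLaw V = 1 := by
    rw [hLdef, lintegral_tsum fun s => (hmeas s).aemeasurable, ← ν.tsum_coe,
      ← tsum_subtype_eq_of_support_subset (s := ν.support) subset_rfl]
    refine tsum_congr fun s => ?_
    rw [← setLIntegral_univ, hdens s _ MeasurableSet.univ, altLaw, Measure.map_apply
      (measurable_arMap ψ _) MeasurableSet.univ, Set.preimage_univ, measure_univ, mul_one]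
  have hrisk : nullLaw V {x | f x = 1} + ∫⁻ x in {x | f x = 1}ᶜ, L x ∂nullLaw V ≤
      avgRisk ν ψ f := by
    rw [avgRisk, hAc, hLdef, lintegral_tsum fun s => (hmeas s).aemeasurable]
    gcongr
    rw [tsum_congr fun s => hdens s _ (hAc ▸ hA.compl)]
    exact ENNReal.tsum_comp_le_tsum_of_injective Subtype.val_injective
      fun s : C => ν s * altLaw ψ (s : List V) {x | f x = 0}
  have hL2 : ∫⁻ x, L x ^ 2 ∂nullLaw V ≤ expOverlap ν (rate ψ) := by
    have hexp : ∀ x, L x ^ 2 = ∑' (s : ν.support) (t : ν.support),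
        ν s * ν t * (pathLik ψ (s : List V) x * pathLik ψ (t : List V) x) := by
      intro x
      rw [sq, hLdef, ← ENNReal.tsum_mul_right]
      refine tsum_congr fun s => ?_
      rw [← ENNReal.tsum_mul_left]
      exact tsum_congr fun t => mul_mul_mul_comm _ _ _ _
    have hm2 : ∀ s t : ν.support, Measurable fun x =>
        ν s * ν t * (pathLik ψ (s : List V) x * pathLik ψ (t : List V) x) := fun s t =>
      ((measurable_pathLik ψ _).mul (measurable_pathLik ψ _)).const_mul _
    rw [lintegral_congr hexp,
      lintegral_tsum fun s => (Measurable.tsum (hm2 s)).aemeasurable, expOverlap]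
    refine le_trans (ENNReal.tsum_le_tsum fun s => ?_)
      (ENNReal.tsum_comp_le_tsum_of_injective (Subtype.val_injective (p := (· ∈ ν.support)))
        fun s : C => ∑' t : C, ν s * ν t *
          ENNReal.ofReal (Real.exp (rate ψ * overlap (s : List V) t)))
    rw [lintegral_tsum fun t => (hm2 s t).aemeasurable]
    refine le_trans (ENNReal.tsum_le_tsum fun t => ?_)
      (ENNReal.tsum_comp_le_tsum_of_injective (Subtype.val_injective (p := (· ∈ ν.support)))
        fun t : C => ν s * ν t * ENNReal.ofReal (Real.exp (rate ψ * overlap (s : List V) t)))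
    have hm : Measurable fun x => pathLik ψ (s : List V) x * pathLik ψ (t : List V) x :=
      (measurable_pathLik ψ _).mul (measurable_pathLik ψ _)
    rw [lintegral_const_mul _ hm]
    gcongr
    exact lintegral_pathLik_mul_pathLik_le hψ (hnd _ s.1.2) (hnd _ t.1.2)
  refine (one_le_add_lintegral_add_sqrt (nullLaw V) hL hL1 hA).trans ?_
  gcongr

end PathDetection

theorem theorem1 {V : Type*} (G : Digraph V) (C : Set (List V))
    (hC : ∀ s ∈ C, PathDetection.IsSelfAvoidingPath G s) (ν : PMF C)
    (ψ : ℝ) (hψ : |ψ| < 1 / 9) :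
    ((PathDetection.bayesRisk ν ψ : ℝ≥0∞) : EReal) ≥
      1 - (((1 / 2) * (PathDetection.expOverlap ν (PathDetection.rate ψ) - 1) ^ (1 / 2 : ℝ) :
        ℝ≥0∞) : EReal) := by
  refine EReal.sub_le_of_le_add ?_
  rw [← EReal.coe_ennreal_one, ← EReal.coe_ennreal_add, EReal.coe_ennreal_le_coe_ennreal_iff,
    ← tsub_le_iff_right]
  refine le_iInf₂ fun f hf => ?_
  rw [tsub_le_iff_right]
  exact PathDetection.one_le_avgRisk_add (fun s hs => (hC s hs).1) (fun s hs => (hC s hs).2.2) ν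
    hψ hf
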